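/- Let $\mathbb F$ be a field, let $C\subseteq\mathbb F^n$ be a linear code of dimension $k$, let $d\in\{0,\dots,n-k\}$ and let $L\ge 1$ be an integer. Then $C$ is $\mathrm{rLD\text{-}MDS}_d(\le L)$ if and only if its dual code $C^\perp=\{x\in\mathbb F^n:\sum_j c_jx_j=0\text{ for all }c\in C\}$ is $\mathrm{rMDS}_d(L+1)$, where these notions are defined as follows. $C$ is $\mathrm{rLD\text{-}MDS}_d(\le L)$ if for every $\ell\in\{1,\dots,L\}$ it is $(\rho_\ell,\ell)$-average-radius list-decodable with $\rho_\ell=\frac{\ell}{\ell+1}\cdot\frac{n-k-d}{n}$; that is, for every $y\in\mathbb F^n$ and all pairwise distinct $c_0,\dots,c_\ell\in C$, $$\frac{1}{\ell+1}\sum_{i=0}^{\ell}\mathrm{wt}(y-c_i)>\rho_\ell\, n,$$ where $\mathrm{wt}$ is the Hamming weight (for $n=0$ the condition is void). For an $m\times n$ matrix $V$ and sets $A_1,\dots,A_\ell\subseteq\{1,\dots,n\}$ let $$\mathcal G_{A_1,\dots,A_\ell}[V]=\begin{pmatrix} I_m & V|_{A_1} & & \\ \vdots & & \ddots & \\ I_m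 & & & V|_{A_\ell}\end{pmatrix},$$ where $V|_A$ consists of the columns of $V$ indexed by $A$ and the omitted blocks are zero. For $\ell\ge2$ and $0\le d\le m$, a linear code of length $n$ and dimension $m$ with generator matrix $G\in\mathbb F^{m\times n}$ (a matrix whose rows form a basis of the code) is $\mathrm{rMDS}_d(\ell)$ if for all $A_1,\dots,A_\ell\subseteq\{1,\dots,n\}$ the matrix $\mathcal G_{A_1,\dots,A_\ell}[G]$ has full column rank whenever $\mathcal G_{A_1,\dots,A_\ell}[W]$ has full column rank, where $W$ is the generic $(m-d)\times n$ matrix, whose entries are independent formal variables over $\mathbb F$ (ranks of matrices in $W$ are taken over the field of rational functions). This does not depend on the choice of $G$. For $C^\perp$ we have $m=n-k$. -/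

import Mathlib

/-- The dual code of a linear code `C` of length `n`: all vectors whose standard bilinear product
with every codeword of `C` is zero. -/
def dualCode {F : Type*} [Field F] {n : ℕ} (C : Submodule F (Fin n → F)) :
    Submodule F (Fin n → F) where
  carrier := {x | ∀ c ∈ C, c ⬝ᵥ x = 0}
  add_mem' := by
    intro x y hx hy c hc
    rw [dotProduct_add, hx c hc, hy c hc, add_zero]
  zero_mem' := by
    intro c _
    exact dotProduct_zero c
  smul_mem' := by
    intro a x hx c hc
    rw [dotProduct_smul, hx c hc, smul_zero]

/-- `G` is a generator matrix of `C`: its rows form a basis of `C`. -/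
def IsGeneratorMatrix {F : Type*} [Field F] {k n : ℕ} (G : Matrix (Fin k) (Fin n) F)
    (C : Submodule F (Fin n → F)) : Prop :=
  LinearIndependent F G.row ∧ Submodule.span F (Set.range G.row) = C

/-- The block matrix `𝒢_{A_1, …, A_ℓ}[V]`, with `ℓ` block rows of height `k`. The `i`-th block row
consists of the identity matrix in the first block column, of the columns of `V` indexed by `A i`
in the block column belonging to `i`, and of zeros elsewhere. -/
def blockMatrix {K : Type*} [Field K] {k n ℓ : ℕ} (V : Matrix (Fin k) (Fin n) K)
    (A : Fin ℓ → Finset (Fin n)) :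
    Matrix (Fin ℓ × Fin k) (Fin k ⊕ (Σ i : Fin ℓ, {j : Fin n // j ∈ A i})) K :=
  Matrix.of fun r c => match c with
    | Sum.inl s => if r.2 = s then 1 else 0
    | Sum.inr p => if r.1 = p.1 then V r.2 p.2 else 0

/-- A matrix has full column rank if its rank is the number of its columns. -/
def HasFullColumnRank {K : Type*} [Field K] {ι κ : Type*} [Fintype κ]
    (M : Matrix ι κ K) : Prop :=
  M.rank = Fintype.card κ

/-- The generic `m × n` matrix over `F`: its entries are independent formal variables, viewed in
the field of rational functions in these variables. -/
noncomputable def genericMatrix (F : Type*) [Field F] (m n : ℕ) :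
    Matrix (Fin m) (Fin n) (FractionRing (MvPolynomial (Fin m × Fin n) F)) :=
  (Matrix.mvPolynomialX (Fin m) (Fin n) F).map
    (algebraMap (MvPolynomial (Fin m × Fin n) F)
      (FractionRing (MvPolynomial (Fin m × Fin n) F)))

/-- Lower relaxation of a higher order MDS code, for a `k × n` matrix `G` (used for `d ≤ k`):
whenever the block matrix of the generic `(k - d) × n` matrix has full column rank,
so does the block matrix of `G`. -/
def IsLowerRelaxedMatrix {F : Type*} [Field F] {k n : ℕ} (G : Matrix (Fin k) (Fin n) F)
    (d ℓ : ℕ) : Prop :=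
  ∀ A : Fin ℓ → Finset (Fin n),
    HasFullColumnRank (blockMatrix (genericMatrix F (k - d) n) A) →
      HasFullColumnRank (blockMatrix G A)

/-- The `(n, k)`-code `C` is `rMDS_d(ℓ)`: it is a code of dimension `k` with a generator matrix
having the lower relaxation property. (The property is the same for all generator matrices.) -/
def IsLowerRelaxedMDS {F : Type*} [Field F] {n : ℕ} (k : ℕ) (C : Submodule F (Fin n → F))
    (d ℓ : ℕ) : Prop :=
  ∃ G : Matrix (Fin k) (Fin n) F, IsGeneratorMatrix G C ∧ IsLowerRelaxedMatrix G d ℓ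

/-- `(ρ, L)` average-radius list-decodability: for each centre `y`, any `L + 1` distinct codewords
have average Hamming distance from `y` larger than `ρ n`. -/
def IsAvgRadiusListDecodable {F : Type*} [Field F] [DecidableEq F] {n : ℕ}
    (C : Submodule F (Fin n → F)) (ρ : ℝ) (L : ℕ) : Prop :=
  ∀ (y : Fin n → F) (c : Fin (L + 1) → Fin n → F), Function.Injective c → (∀ i, c i ∈ C) →
    ρ * (n : ℝ) < (1 / ((L : ℝ) + 1)) * ∑ i, (hammingNorm (y - c i) : ℝ)

/-- The radius `ρ_{n,k,d}(L) = (L / (L + 1)) (n - k - d) / n`. -/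
noncomputable def relaxedRadius (n k d L : ℕ) : ℝ :=
  ((L : ℝ) / ((L : ℝ) + 1)) * (((n : ℝ) - (k : ℝ) - (d : ℝ)) / (n : ℝ))

/-- The `(n, k)`-code `C` is `rLD-MDS_d(L)`. -/
def IsRelaxedLDMDS {F : Type*} [Field F] [DecidableEq F] {n : ℕ} (k : ℕ)
    (C : Submodule F (Fin n → F)) (d L : ℕ) : Prop :=
  IsAvgRadiusListDecodable C (relaxedRadius n k d L) L

/-- The `(n, k)`-code `C` is `rLD-MDS_d(≤ L)`. -/
def IsRelaxedLDMDSLe {F : Type*} [Field F] [DecidableEq F] {n : ℕ} (k : ℕ)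
    (C : Submodule F (Fin n → F)) (d L : ℕ) : Prop :=
  ∀ ℓ ∈ Finset.Icc 1 L, IsRelaxedLDMDS k C d ℓ

/-!
Write `p = n - k - d`, and for a family `A` of column sets and a set `I` of indices write `A_I` for
`⋂ i ∈ I, A i`. The block matrix of `V` and `A` has trivial kernel exactly if the only vectors
`x i`, supported in `A i`, with all `V x_i` equal are the zero vectors (`IntersectTrivially`). For
a parity check matrix `H` of `C`, vectors with a common syndrome are of the form `y - c i` with
`c i ∈ C`, so bad lists of codewords and kernel vectors are the same kind of object, and what has to
be understood is the generic matrix. The link is the family of inequalities `∑ |A_P| + p ≤ s p`, one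
for each partition of the index set into `s` parts `P` (`PartitionBound`).

From list decoding to the dual code: if the vectors `x i` lie in the kernel of the block matrix of
`H`, group the indices by the value of `x i`. The distinct values form a list with total weight at
most `∑ |A_P|`. Full column rank of the block matrix of the generic matrix for the sets `A_P`
bounds this by `(s - 1) p`, simply because there are at least as many rows as columns
(`IntersectTrivially.sum_card_add_le`), which contradicts list decodability with list size `s - 1`.

From the dual code to list decoding: among the sublists of a bad list that are still bad after
moving the centre, a minimal one satisfies, for a suitable centre, all inequalities of
`PartitionBound`, because on a part `P` the centre can be moved so as to gain `|A_P|`, and the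
smaller list obtained is not bad (`exists_partitionBound`). It remains to see that these
inequalities force full column rank for the generic matrix. The function `I ↦ p - |A_I|` is
submodular on intersecting sets, so uncrossing tight sets yields weights `δ i` with sum `p` and
`∑ i ∈ I, δ i ≤ p - |A_I|` (`PartitionBound.exists_weights`). Take the generic matrix with `δ i`
of its rows set to zero on the columns in `A i`. If all `V x_i` agree, each of their coordinates
vanishes, since one of the `V x_i` is zero there; and by Hall's theorem the columns in `A i` are
independent (`PartitionBound.exists_intersectTrivially`). Full column rank lifts from this
specialization to the generic matrix, as it is witnessed by a minor.
-/

open Module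

/-! ### Kernels of the block matrices -/

/-- The block matrix of `V` and `A` has trivial kernel: if each `x i` is supported in `A i` and the
products `V x_i` all agree, then every `x i` is zero. For nonempty `ι` this says that the columns of
`V` in each `A i` are independent and that the spans of these columns intersect in zero. -/
def IntersectTrivially {K ι κ m : Type*} [Field K] [Fintype κ] (V : Matrix m κ K)
    (A : ι → Finset κ) : Prop :=
  ∀ x : ι → κ → K, (∀ i, ∀ j ∉ A i, x i j = 0) → (∀ i i', V.mulVec (x i) = V.mulVec (x i')) →
    x = 0

theorem hasFullColumnRank_iff_injective {K ι κ : Type*} [Field K] [Fintype κ] (M : Matrix ι κ K) :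
    HasFullColumnRank M ↔ Function.Injective M.mulVec := by
  classical
  rw [HasFullColumnRank, Matrix.mulVec_injective_iff, linearIndependent_iff_card_eq_finrank_span,
    Matrix.rank_eq_finrank_span_cols, eq_comm]
  rfl

/-- On a vector assembled from `v` and from vectors `x i` supported in `A i`, the `i`-th block of
the product with the block matrix is `v + V x_i`. -/
theorem blockMatrix_mulVec {K : Type*} [Field K] {p n ℓ : ℕ} (V : Matrix (Fin p) (Fin n) K)
    (A : Fin ℓ → Finset (Fin n)) (v : Fin p → K) (x : Fin ℓ → Fin n → K)
    (hx : ∀ i, ∀ j ∉ A i, x i j = 0) (i : Fin ℓ) (r : Fin p) :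
    (blockMatrix V A).mulVec (Sum.elim v fun q => x q.1 q.2) (i, r) =
      v r + V.mulVec (x i) r := by
  simp only [Matrix.mulVec, dotProduct, blockMatrix, Fintype.sum_sum_type, Matrix.of_apply,
    Sum.elim_inl, Sum.elim_inr, ite_mul, one_mul, zero_mul, Finset.sum_ite_eq, Finset.mem_univ,
    if_true, Fintype.sum_sigma]
  congr 1
  rw [Finset.sum_eq_single i (fun b _ hb => by simp [hb.symm]) (by simp)]
  simp only [if_true]
  rw [Finset.sum_coe_sort (A i) (fun j => V r j * x i j)]
  exact Finset.sum_subset (Finset.subset_univ _) fun j _ hj => by rw [hx i j hj, mul_zero]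

/-- At least one block row is needed: for `ℓ = 0` the block matrix has `p` columns and no rows,
while `IntersectTrivially` holds vacuously. -/
theorem hasFullColumnRank_blockMatrix_iff {K : Type*} [Field K] {p n ℓ : ℕ} [NeZero ℓ]
    (V : Matrix (Fin p) (Fin n) K) (A : Fin ℓ → Finset (Fin n)) :
    HasFullColumnRank (blockMatrix V A) ↔ IntersectTrivially V A := by
  rw [hasFullColumnRank_iff_injective]
  constructor
  · intro h x hx hV
    have key : (Sum.elim (-V.mulVec (x 0)) fun q => x q.1 q.2 :
        Fin p ⊕ (Σ i : Fin ℓ, {j : Fin n // j ∈ A i}) → K) = 0 := by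
      apply h
      ext ⟨i, r⟩
      rw [blockMatrix_mulVec V A _ x hx, hV i 0, Matrix.mulVec_zero]
      simp
    ext i j
    by_cases hj : j ∈ A i
    · exact congrFun key (Sum.inr ⟨i, j, hj⟩)
    · exact hx i j hj
  · intro h
    change Function.Injective (blockMatrix V A).mulVecLin
    rw [injective_iff_map_eq_zero]
    intro w hw
    set x : Fin ℓ → Fin n → K := fun i j => if hj : j ∈ A i then w (Sum.inr ⟨i, j, hj⟩) else 0
      with hxdef
    have hx : ∀ i, ∀ j ∉ A i, x i j = 0 := fun i j hj => dif_neg hj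
    have hwx : w = Sum.elim (fun r => w (Sum.inl r)) fun q => x q.1 q.2 := by
      ext (r | ⟨i, j, hj⟩)
      · rfl
      · simp [hxdef]
    have hVx : ∀ i r, w (Sum.inl r) + V.mulVec (x i) r = 0 := fun i r => by
      rw [← blockMatrix_mulVec V A (fun r => w (Sum.inl r)) x hx, ← hwx]
      exact congrFun hw (i, r)
    have hx0 : x = 0 := h x hx fun i i' => by
      ext r
      linear_combination hVx i r - hVx i' r
    rw [hwx, hx0]
    ext (r | q)
    · simpa [hx0] using hVx 0 r
    · rfl

theorem exists_det_submatrix_ne_zero {K ι κ : Type*} [Field K] [Fintype ι] [Fintype κ]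
    [DecidableEq κ] (M : Matrix ι κ K) (h : HasFullColumnRank M) :
    ∃ f : κ → ι, (M.submatrix f id).det ≠ 0 := by
  obtain ⟨g, hg, -, hli⟩ := Submodule.exists_fun_fin_finrank_span_eq K (Set.range M.row)
  choose f hf using hg
  let e : κ ≃ Fin (finrank K (Submodule.span K (Set.range M.row))) :=
    Fintype.equivFinOfCardEq (by rw [← Matrix.rank_eq_finrank_span_row, h])
  refine ⟨f ∘ e, ?_⟩
  rw [← isUnit_iff_ne_zero, ← Matrix.isUnit_iff_isUnit_det,
    ← Matrix.linearIndependent_rows_iff_isUnit]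
  have hrow : (M.submatrix (f ∘ e) id).row = g ∘ e := funext fun a => hf (e a)
  rw [hrow]
  exact hli.comp _ e.injective

theorem hasFullColumnRank_of_det_submatrix_ne_zero {K ι κ : Type*} [Field K] [Fintype κ]
    [DecidableEq κ] (M : Matrix ι κ K) (f : κ → ι) (h : (M.submatrix f id).det ≠ 0) :
    HasFullColumnRank M := by
  rw [hasFullColumnRank_iff_injective]
  intro x y hxy
  apply Matrix.mulVec_injective_of_det_ne_zero h
  ext a
  exact congrFun hxy (f a)

/-- Full column rank after some specialization `ψ` implies full column rank over a field containing
the ring of entries: a nonzero maximal minor after specialization is nonzero before it. -/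
theorem hasFullColumnRank_map_of_map {R K K' ι κ : Type*} [CommRing R] [Field K] [Field K']
    [Fintype ι] [Fintype κ] (M : Matrix ι κ R) (φ : R →+* K) (ψ : R →+* K')
    (hφ : Function.Injective φ) (h : HasFullColumnRank (M.map ψ)) :
    HasFullColumnRank (M.map φ) := by
  classical
  obtain ⟨f, hf⟩ := exists_det_submatrix_ne_zero _ h
  refine hasFullColumnRank_of_det_submatrix_ne_zero _ f ?_
  rw [Matrix.submatrix_map, ← RingHom.mapMatrix_apply, ← RingHom.map_det] at hf ⊢
  rw [map_ne_zero_iff φ hφ]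
  exact fun h0 => hf (by rw [h0, map_zero])

theorem hasFullColumnRank_blockMatrix_genericMatrix {F K : Type*} [Field F] [Field K]
    [Algebra F K] {p n ℓ : ℕ} (V : Matrix (Fin p) (Fin n) K) (A : Fin ℓ → Finset (Fin n))
    (h : HasFullColumnRank (blockMatrix V A)) :
    HasFullColumnRank (blockMatrix (genericMatrix F p n) A) := by
  let M : Matrix (Fin ℓ × Fin p) (Fin p ⊕ (Σ i : Fin ℓ, {j : Fin n // j ∈ A i}))
      (MvPolynomial (Fin p × Fin n) F) :=
    Matrix.of fun r => Sum.elim (fun s => if r.2 = s then 1 else 0)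
      fun q => if r.1 = q.1 then MvPolynomial.X (r.2, (q.2 : Fin n)) else 0
  have hgen : blockMatrix (genericMatrix F p n) A =
      M.map (algebraMap _ (FractionRing (MvPolynomial (Fin p × Fin n) F))) := by
    ext r (s | q)
    · simp [blockMatrix, M, apply_ite]
    · by_cases hr : r.1 = q.1 <;> simp [blockMatrix, M, genericMatrix, hr]
  have hV : blockMatrix V A =
      M.map (MvPolynomial.aeval fun q : Fin p × Fin n => V q.1 q.2 :
        MvPolynomial (Fin p × Fin n) F →ₐ[F] K).toRingHom := by
    ext r (s | q)
    · simp [blockMatrix, M, apply_ite]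
    · by_cases hr : r.1 = q.1 <;> simp [blockMatrix, M, hr]
  rw [hgen]
  rw [hV] at h
  exact hasFullColumnRank_map_of_map M _ _ (IsFractionRing.injective _ _) h

/-- Repeating members of the family `A` creates no kernel vectors. -/
theorem IntersectTrivially.comp {K ι ι' κ m : Type*} [Field K] [Fintype κ] {V : Matrix m κ K}
    {A : ι → Finset κ} (h : IntersectTrivially V A) {π : ι' → ι} (hπ : Function.Surjective π) :
    IntersectTrivially V (A ∘ π) := by
  classical
  intro x hx hV
  ext i' j
  -- a section of `π` through the given point `i'`
  set σ := Function.update (Function.surjInv hπ) (π i') i' with hσ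
  have hsec : ∀ i, π (σ i) = i := fun i => by
    by_cases hi : i = π i'
    · simp [hσ, hi]
    · simp [hσ, hi, Function.surjInv_eq hπ]
  have h0 := h (x ∘ σ) (fun i j hj => hx (σ i) j (by simpa [hsec] using hj)) fun _ _ => hV _ _
  simpa [hσ] using congrFun (congrFun h0 (π i')) j

/-- A matrix of full column rank has at least as many rows as columns; for the block matrix this is
the stated inequality. -/
theorem IntersectTrivially.sum_card_add_le {K : Type*} [Field K] {p n s : ℕ} [NeZero s]
    {V : Matrix (Fin p) (Fin n) K} {B : Fin s → Finset (Fin n)} (h : IntersectTrivially V B) :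
    ∑ b, (B b).card + p ≤ s * p := by
  have h1 := (hasFullColumnRank_blockMatrix_iff V B).2 h
  have h2 := (blockMatrix V B).rank_le_card_height
  rw [h1] at h2
  simpa [add_comm] using h2

/-! ### Partition bounds and generic matrices -/

/-- The intersection of the sets `A i` over `i ∈ I`. -/
def commonPart {ι κ : Type*} [Fintype κ] [DecidableEq κ] (A : ι → Finset κ) (I : Finset ι) :
    Finset κ :=
  {j | ∀ i ∈ I, j ∈ A i}

@[simp]
theorem mem_commonPart {ι κ : Type*} [Fintype κ] [DecidableEq κ] {A : ι → Finset κ}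
    {I : Finset ι} {j : κ} : j ∈ commonPart A I ↔ ∀ i ∈ I, j ∈ A i := by
  simp [commonPart]

/-- Supermodularity of the size of the common part. For disjoint `I` and `J` the last term is the
size of the whole type. -/
theorem card_commonPart_add_le {ι κ : Type*} [DecidableEq ι] [Fintype κ] [DecidableEq κ]
    (A : ι → Finset κ) (I J : Finset ι) :
    (commonPart A I).card + (commonPart A J).card ≤
      (commonPart A (I ∪ J)).card + (commonPart A (I ∩ J)).card := by
  have h1 : commonPart A I ∩ commonPart A J = commonPart A (I ∪ J) := by
    ext j
    simp only [Finset.mem_inter, mem_commonPart, Finset.mem_union, or_imp, forall_and]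
  have h2 : commonPart A I ∪ commonPart A J ⊆ commonPart A (I ∩ J) := by
    intro j
    simp only [Finset.mem_union, mem_commonPart, Finset.mem_inter]
    rintro (h | h) i hi
    exacts [h i hi.1, h i hi.2]
  rw [← Finset.card_union_add_card_inter, h1, add_comm]
  exact Nat.add_le_add_left (Finset.card_le_card h2) _

/-- For every partition of `ι` into `s` nonempty parts `P`, the sizes of the common parts of `A`
over the parts sum to at most `(s - 1) p`. Partitions are encoded as the fibres of functions `g` on
`ι`; labels in `Finset ι` suffice, as a part can be its own label. The inequality is written without
subtraction. -/
def PartitionBound {ι κ : Type*} [Fintype ι] [DecidableEq ι] [Fintype κ] [DecidableEq κ]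
    (A : ι → Finset κ) (p : ℕ) : Prop :=
  ∀ g : ι → Finset ι, ∑ b ∈ Finset.univ.image g, (commonPart A {i | g i = b}).card + p ≤
    (Finset.univ.image g).card * p

theorem PartitionBound.card_commonPart_le {ι κ : Type*} [Fintype ι] [DecidableEq ι] [Fintype κ]
    [DecidableEq κ] {A : ι → Finset κ} {p : ℕ} (h : PartitionBound A p) {I : Finset ι}
    (hI : I.Nonempty) : (commonPart A I).card ≤ p := by
  obtain ⟨i, hi⟩ := hI
  -- the partition into `I` and its complement
  let g : ι → Finset ι := fun i' => if i' ∈ I then I else ∅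
  have hfib : ({i' | g i' = I} : Finset ι) = I := by
    ext i'
    have : ∅ ≠ I := fun h0 => by simp [← h0] at hi
    by_cases hi' : i' ∈ I <;> simp [g, hi', this]
  have h1 := Finset.single_le_sum (f := fun b => (commonPart A {i' | g i' = b}).card)
    (fun _ _ => Nat.zero_le _)
    (Finset.mem_image.2 ⟨i, Finset.mem_univ i, by simp [g, hi]⟩ : I ∈ Finset.univ.image g)
  have h2 : (Finset.univ.image g).card ≤ 2 := by
    refine (Finset.card_le_card (t := {I, ∅}) ?_).trans Finset.card_le_two
    rw [Finset.image_subset_iff]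
    intro i' _
    by_cases hi' : i' ∈ I <;> simp [g, hi']
  have h3 := h g
  have h4 := Nat.mul_le_mul_right p h2
  simp only [hfib] at h1
  omega

/-- The weights are a maximal `δ` among those satisfying the inequalities. By maximality every index
lies in a tight set, tight sets that meet have a tight union, and so the maximal tight sets form a
partition; the bound for this partition gives `∑ i, δ i ≥ p`. -/
theorem PartitionBound.exists_weights {ι κ : Type*} [Fintype ι] [DecidableEq ι] [Nonempty ι]
    [Fintype κ] [DecidableEq κ] {A : ι → Finset κ} {p : ℕ} (h : PartitionBound A p) :
    ∃ δ : ι → ℕ, ∑ i, δ i = p ∧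
      ∀ I : Finset ι, I.Nonempty → ∑ i ∈ I, δ i + (commonPart A I).card ≤ p := by
  let S : Set ℕ := {m | ∃ δ : ι → ℕ, ∑ i, δ i = m ∧
      ∀ I : Finset ι, I.Nonempty → ∑ i ∈ I, δ i + (commonPart A I).card ≤ p}
  have hS0 : S.Nonempty := ⟨0, fun _ => 0, by simp, fun I hI => by
    simpa using h.card_commonPart_le hI⟩
  have hSp : p ∈ upperBounds S := by
    rintro m ⟨δ, rfl, hδ⟩
    exact (Nat.le_add_right _ _).trans (hδ Finset.univ Finset.univ_nonempty)
  obtain ⟨δ, hδS, hδ⟩ := Nat.sSup_mem hS0 ⟨p, hSp⟩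
  have hmax : ∀ m ∈ S, m ≤ ∑ i, δ i := fun m hm => hδS ▸ le_csSup ⟨p, hSp⟩ hm
  refine ⟨δ, le_antisymm (hSp ⟨δ, rfl, hδ⟩) ?_, hδ⟩
  let Tight : Finset ι → Prop := fun I => ∑ i ∈ I, δ i + (commonPart A I).card = p
  have hunion : ∀ I J : Finset ι, Tight I → Tight J → (I ∩ J).Nonempty → Tight (I ∪ J) := by
    intro I J hI hJ hIJ
    have h1 := card_commonPart_add_le A I J
    have h2 := Finset.sum_union_inter (s₁ := I) (s₂ := J) (f := δ)
    have h3 := hδ _ hIJ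
    have h4 := hδ _ (hIJ.mono (Finset.inter_subset_left.trans Finset.subset_union_left) :
      (I ∪ J).Nonempty)
    simp only [Tight] at hI hJ ⊢
    omega
  -- otherwise `δ i` could be increased by one
  have hex : ∀ i, ∃ I, i ∈ I ∧ Tight I := by
    intro i
    by_contra! hno
    have hmem : ∑ i', (δ i' + if i' = i then 1 else 0) ∈ S := by
      refine ⟨_, rfl, fun I hI => ?_⟩
      rw [Finset.sum_add_distrib, Finset.sum_ite_eq']
      have h1 := hδ I hI
      split_ifs with hi
      · have h2 := hno I hi
        simp only [Tight] at h2
        omega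
      · omega
    have h1 := hmax _ hmem
    rw [Finset.sum_add_distrib, Finset.sum_ite_eq'] at h1
    simp at h1
  -- a tight set of maximal size through `i` contains every tight set it meets
  have hT : ∀ i, ∃ T, (i ∈ T ∧ Tight T) ∧ ∀ I, Tight I → (I ∩ T).Nonempty → I ⊆ T := by
    intro i
    classical
    obtain ⟨I₀, hI₀⟩ := hex i
    obtain ⟨T, hTmem, hTmax⟩ := Finset.exists_max_image
      (Finset.univ.filter fun I : Finset ι => i ∈ I ∧ Tight I) Finset.card ⟨I₀, by simpa using hI₀⟩
    simp only [Finset.mem_filter, Finset.mem_univ, true_and] at hTmem hTmax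
    refine ⟨T, hTmem, fun I hI hIT => ?_⟩
    have h1 := hTmax (I ∪ T) ⟨Finset.mem_union_right _ hTmem.1, hunion _ _ hI hTmem.2 hIT⟩
    rw [Finset.eq_of_subset_of_card_le Finset.subset_union_right h1]
    exact Finset.subset_union_left
  choose T hT hTmax using hT
  have hfib : ∀ i, ({i' | T i' = T i} : Finset ι) = T i := by
    intro i
    ext i'
    simp only [Finset.mem_filter, Finset.mem_univ, true_and]
    constructor
    · intro h'
      exact h' ▸ (hT i').1
    · intro h'
      exact (hTmax i _ (hT i').2 ⟨i', by simp [h', (hT i').1]⟩).antisymm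
        (hTmax i' _ (hT i).2 ⟨i', by simp [h', (hT i').1]⟩)
  -- the maximal tight sets form a partition, with fibre `T i` over the label `T i`
  have hsum : ∑ i, δ i + ∑ b ∈ Finset.univ.image T, (commonPart A {i | T i = b}).card =
      (Finset.univ.image T).card * p := by
    rw [← Finset.sum_fiberwise_of_maps_to (g := T) (t := Finset.univ.image T)
      (fun i hi => Finset.mem_image_of_mem T hi), ← Finset.sum_add_distrib, ← smul_eq_mul,
      ← Finset.sum_const]
    refine Finset.sum_congr rfl fun b hb => ?_
    obtain ⟨i, -, rfl⟩ := Finset.mem_image.1 hb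
    rw [hfib]
    exact (hT i).2
  have := h T
  omega

/-- A colouring of the rows that uses the colour `i` for exactly `δ i` rows. -/
theorem exists_coloring {ι : Type*} [Fintype ι] [DecidableEq ι] {p : ℕ} (δ : ι → ℕ)
    (h : ∑ i, δ i = p) :
    ∃ col : Fin p → ι, ∀ I : Finset ι,
      (Finset.univ.filter fun r => col r ∈ I).card = ∑ i ∈ I, δ i := by
  let e : Fin p ≃ Σ i, Fin (δ i) := Fintype.equivOfCardEq (by simp [h])
  refine ⟨fun r => (e r).1, fun I => ?_⟩
  have : (Finset.univ.filter fun r => (e r).1 ∈ I).map e.toEmbedding =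
      I.sigma fun _ => Finset.univ := by
    ext q
    simp only [Finset.mem_map_equiv, Finset.mem_filter, Finset.mem_univ, true_and,
      Equiv.apply_symm_apply, Finset.mem_sigma, and_true]
  rw [← Finset.card_map e.toEmbedding, this, Finset.card_sigma]
  simp

/-- Hall's theorem for the columns in `A i` and the rows, a column `j` being joined to the rows that
do not vanish at `j`. -/
theorem exists_matching {ι : Type*} [Fintype ι] [DecidableEq ι] {p n : ℕ}
    {A : ι → Finset (Fin n)} {col : Fin p → ι}
    (h : ∀ I : Finset ι, I.Nonempty →
      (Finset.univ.filter fun r => col r ∈ I).card + (commonPart A I).card ≤ p) (i : ι) :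
    ∃ m : {j // j ∈ A i} → Fin p, Function.Injective m ∧ ∀ a, (a : Fin n) ∉ A (col (m a)) := by
  obtain ⟨m, hm, hmem⟩ := (Finset.all_card_le_biUnion_card_iff_exists_injective
    (fun a : {j // j ∈ A i} => Finset.univ.filter fun r => (a : Fin n) ∉ A (col r))).1 fun s => by
      -- the rows without neighbours in `s` are those with colour in `I`, and `s` lies in `A_I`
      let I : Finset ι := {i' | ∀ a ∈ s, (a : Fin n) ∈ A i'}
      have h1 := h I ⟨i, by simp +contextual [I]⟩
      have h2 : s.card ≤ (commonPart A I).card := by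
        rw [← Finset.card_map (Function.Embedding.subtype _)]
        refine Finset.card_le_card fun j hj => ?_
        obtain ⟨a, ha, rfl⟩ := Finset.mem_map.1 hj
        simp only [mem_commonPart, I, Finset.mem_filter, Finset.mem_univ, true_and]
        exact fun i' hi' => hi' a ha
      have h3 : (Finset.univ : Finset (Fin p)) ⊆ (Finset.univ.filter fun r => col r ∈ I) ∪
          s.biUnion fun a => Finset.univ.filter fun r => (a : Fin n) ∉ A (col r) := by
        intro r _
        simp only [I, Finset.mem_union, Finset.mem_filter, Finset.mem_univ, true_and,
          Finset.mem_biUnion]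
        by_contra! h'
        obtain ⟨⟨a, ha, hn⟩, h'⟩ := h'
        exact hn (h' a ha)
      have h4 := (Finset.card_le_card h3).trans (Finset.card_union_le _ _)
      rw [Finset.card_univ, Fintype.card_fin] at h4
      omega
  exact ⟨m, hm, fun a => by simpa using hmem a⟩

/-- The matrix is the generic one with row `r` replaced by zero on the columns in `A (col r)`, where
each colour `i` is used for `δ i` rows. -/
theorem PartitionBound.exists_intersectTrivially (F : Type*) [Field F] {ι : Type*} [Fintype ι]
    [DecidableEq ι] [Nonempty ι] {p n : ℕ} {A : ι → Finset (Fin n)} (h : PartitionBound A p) :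
    ∃ V : Matrix (Fin p) (Fin n) (FractionRing (MvPolynomial (Fin p × Fin n) F)),
      IntersectTrivially V A := by
  obtain ⟨δ, hsum, hδ⟩ := h.exists_weights
  obtain ⟨col, hcol⟩ := exists_coloring δ hsum
  have hmatch := exists_matching (A := A) (col := col) fun I hI => hcol I ▸ hδ I hI
  let P : Matrix (Fin p) (Fin n) (MvPolynomial (Fin p × Fin n) F) :=
    Matrix.of fun r j => if j ∈ A (col r) then 0 else MvPolynomial.X (r, j)
  let φ := algebraMap (MvPolynomial (Fin p × Fin n) F)
    (FractionRing (MvPolynomial (Fin p × Fin n) F))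
  refine ⟨P.map φ, fun x hx hV => ?_⟩
  -- compare with `x (col r)`, whose support is contained in the zero set of row `r`
  have hzero : ∀ i r, (P.map φ).mulVec (x i) r = 0 := by
    intro i r
    rw [hV i (col r), Matrix.mulVec, dotProduct]
    refine Finset.sum_eq_zero fun j _ => ?_
    by_cases hj : j ∈ A (col r)
    · simp [P, hj]
    · rw [hx _ j hj, mul_zero]
  funext i
  obtain ⟨m, hm, hmA⟩ := hmatch i
  have hdet : (P.submatrix m (Subtype.val : {j // j ∈ A i} → Fin n)).det ≠ 0 := by
    classical
    intro h0
    -- setting the variables of the matching to one and the others to zero turns the submatrix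
    -- into the identity matrix
    let ev : MvPolynomial (Fin p × Fin n) F →+* F :=
      MvPolynomial.eval fun q => if ∃ a, m a = q.1 ∧ (a : Fin n) = q.2 then 1 else 0
    have hone : ev.mapMatrix (P.submatrix m (Subtype.val : {j // j ∈ A i} → Fin n)) = 1 := by
      ext a b
      simp only [RingHom.mapMatrix_apply, Matrix.map_apply, Matrix.submatrix_apply, P,
        Matrix.of_apply]
      by_cases hab : a = b
      · subst hab
        rw [if_neg (hmA a), Matrix.one_apply_eq]
        simp only [ev, MvPolynomial.eval_X]
        rw [if_pos ⟨a, rfl, rfl⟩]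
      · rw [Matrix.one_apply_ne hab]
        split_ifs
        · exact map_zero _
        · simp only [ev, MvPolynomial.eval_X]
          rw [if_neg]
          rintro ⟨c, hc, hcb⟩
          exact hab (hm hc ▸ Subtype.ext hcb)
    have := congrArg Matrix.det hone
    rw [← RingHom.map_det, h0, map_zero, Matrix.det_one] at this
    exact zero_ne_one this
  have hdet' : ((P.map φ).submatrix m (Subtype.val : {j // j ∈ A i} → Fin n)).det ≠ 0 := by
    rw [Matrix.submatrix_map, ← RingHom.mapMatrix_apply, ← RingHom.map_det]
    exact (map_ne_zero_iff φ (IsFractionRing.injective _ _)).2 hdet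
  have hres : (fun a : {j // j ∈ A i} => x i a) = 0 := by
    refine Matrix.eq_zero_of_mulVec_eq_zero hdet' ?_
    ext a
    rw [Pi.zero_apply, ← hzero i (m a)]
    simp only [Matrix.mulVec, dotProduct, Matrix.submatrix_apply]
    rw [Finset.sum_coe_sort (A i) (fun j => (P.map φ) (m a) j * x i j)]
    exact Finset.sum_subset (Finset.subset_univ _) fun j _ hj => by rw [hx i j hj, mul_zero]
  ext j
  by_cases hj : j ∈ A i
  · exact congrFun hres ⟨j, hj⟩
  · exact hx i j hj

/-! ### Lists of small total weight -/

/-- Subtracting one vector `u` from all `x i` with `i ∈ I` can make every coordinate vanish for some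
`i`, and lowers the total weight by at least the number of coordinates where no `x i` vanished. -/
theorem exists_shift {F ι : Type*} [Field F] [DecidableEq F] {n : ℕ} (x : ι → Fin n → F)
    {I : Finset ι} (hI : I.Nonempty) :
    ∃ u : Fin n → F, (∀ j, ∃ i ∈ I, x i j = u j) ∧
      ∑ i ∈ I, hammingNorm (x i - u) + (commonPart (fun i => {j | x i j ≠ 0}) I).card ≤
        ∑ i ∈ I, hammingNorm (x i) := by
  classical
  obtain ⟨i₀, hi₀⟩ := hI
  set T := commonPart (fun i => ({j | x i j ≠ 0} : Finset (Fin n))) I with hT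
  have hmem : ∀ j, j ∈ T ↔ ∀ i ∈ I, x i j ≠ 0 := fun j => by simp [hT]
  refine ⟨fun j => if j ∈ T then x i₀ j else 0, fun j => ?_, ?_⟩
  · by_cases hj : j ∈ T
    · exact ⟨i₀, hi₀, by simp [hj]⟩
    · have hj' := hj
      rw [hmem] at hj'
      push Not at hj'
      obtain ⟨i, hi, hij⟩ := hj'
      exact ⟨i, hi, by simp [hj, hij]⟩
  · rw [← Finset.add_sum_erase I _ hi₀, ← Finset.add_sum_erase I _ hi₀]
    have h1 : hammingNorm (x i₀ - fun j => if j ∈ T then x i₀ j else 0) + T.card ≤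
        hammingNorm (x i₀) := by
      rw [hammingNorm, hammingNorm, ← Finset.card_union_of_disjoint]
      · refine Finset.card_le_card fun j => ?_
        by_cases hj : j ∈ T
        · simp [hj, (hmem j).1 hj i₀ hi₀]
        · simp [hj]
      · rw [Finset.disjoint_left]
        intro j hj hjT
        simp [hjT] at hj
    have h2 : ∑ i ∈ I.erase i₀, hammingNorm (x i - fun j => if j ∈ T then x i₀ j else 0) ≤
        ∑ i ∈ I.erase i₀, hammingNorm (x i) := by
      refine Finset.sum_le_sum fun i hi => ?_
      refine Finset.card_le_card fun j => ?_
      by_cases hj : j ∈ T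
      · simp [(hmem j).1 hj i (Finset.mem_of_mem_erase hi)]
      · simp [hj]
    omega

/-- A list of small total weight contains a sublist `J` which, after a shift by some `u`, has
supports satisfying `PartitionBound`. The sublist is a minimal one of small total weight
up to shifts. -/
theorem exists_partitionBound {F ι : Type*} [Field F] [DecidableEq F] [Fintype ι] [DecidableEq ι]
    {n p : ℕ} (x : ι → Fin n → F) (hι : 2 ≤ Fintype.card ι)
    (hx : ∑ i, hammingNorm (x i) + p ≤ Fintype.card ι * p) :
    ∃ (J : Finset ι) (u : Fin n → F), 2 ≤ J.card ∧
      PartitionBound (fun i : J => ({j | x i j ≠ u j} : Finset (Fin n))) p := by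
  classical
  obtain ⟨J, hJmem, hJmin⟩ := Finset.exists_min_image
    (Finset.univ.filter fun J : Finset ι => 2 ≤ J.card ∧
      ∃ u : Fin n → F, ∑ i ∈ J, hammingNorm (x i - u) + p ≤ J.card * p) Finset.card
    ⟨Finset.univ, by simpa using ⟨hι, 0, by simpa using hx⟩⟩
  simp only [Finset.mem_filter, Finset.mem_univ, true_and] at hJmem hJmin
  obtain ⟨hJ2, u, hu⟩ := hJmem
  obtain ⟨u', hu'0, hu'⟩ := exists_shift (fun i => x i - u)
    (Finset.card_pos.1 (by omega) : J.Nonempty)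
  refine ⟨J, u + u', hJ2, fun g => ?_⟩
  set z : J → Fin n → F := fun i => x i - (u + u') with hz
  have hA : (fun i : J => ({j | x i j ≠ (u + u') j} : Finset (Fin n))) =
      fun i => ({j | z i j ≠ 0} : Finset (Fin n)) := by
    ext i j
    simp [hz, sub_eq_zero]
  rw [hA]
  have hzsum : ∑ i, hammingNorm (z i) + p ≤ J.card * p := by
    have h1 : ∑ i, hammingNorm (z i) = ∑ i ∈ J, hammingNorm (x i - u - u') := by
      rw [← Finset.sum_coe_sort J]
      simp only [hz, sub_add_eq_sub_sub]
    omega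
  obtain hs | hs := Nat.lt_or_ge 1 (Finset.univ.image g).card
  -- with at least two parts, each part is a proper sublist, to which minimality applies
  · have hclass : ∀ b ∈ Finset.univ.image g,
        (commonPart (fun i => ({j | z i j ≠ 0} : Finset (Fin n))) {i | g i = b}).card +
          ({i | g i = b} : Finset J).card * p ≤
        ∑ i with g i = b, hammingNorm (z i) + p := by
      intro b hb
      set I : Finset J := {i | g i = b} with hI
      have hIne : I.Nonempty := by
        obtain ⟨i, -, hi⟩ := Finset.mem_image.1 hb
        exact ⟨i, by simp [hI, hi]⟩
      obtain ⟨v, -, hv⟩ := exists_shift z hIne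
      obtain hI1 | hI2 : I.card = 1 ∨ 2 ≤ I.card := by
        have := hIne.card_pos
        omega
      · rw [hI1]
        omega
      · have hlt : I.card < J.card := by
          obtain ⟨b', hb', hne⟩ := Finset.exists_mem_ne hs b
          obtain ⟨i', -, hi'⟩ := Finset.mem_image.1 hb'
          rw [← Fintype.card_coe J, ← Finset.card_univ]
          refine Finset.card_lt_card ((Finset.ssubset_univ_iff).2 fun hall => hne ?_)
          have : i' ∈ I := hall ▸ Finset.mem_univ i'
          rw [← hi']
          simpa [hI] using this
        have hno : ¬ (∑ i ∈ I, hammingNorm (z i - v) + p ≤ I.card * p) := by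
          intro hle
          have h1 := hJmin (I.map (Function.Embedding.subtype _)) ⟨by rwa [Finset.card_map],
            u + u' + v, by
              rw [Finset.card_map, Finset.sum_map]
              simp only [hz, sub_add_eq_sub_sub] at hle ⊢
              exact hle⟩
          rw [Finset.card_map] at h1
          omega
        omega
    have h1 := Finset.sum_le_sum hclass
    rw [Finset.sum_add_distrib, Finset.sum_add_distrib, ← Finset.sum_mul,
      ← Finset.card_eq_sum_card_image, Finset.sum_const, smul_eq_mul,
      Finset.sum_fiberwise_of_maps_to fun i hi => Finset.mem_image_of_mem g hi,
      Finset.card_univ, Fintype.card_coe] at h1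
    omega
  -- with a single part, the shift by `u'` has made the common part empty
  · obtain ⟨i₀, hi₀⟩ : J.Nonempty := Finset.card_pos.1 (by omega)
    have hb : ∀ i, g i = g ⟨i₀, hi₀⟩ := fun i => Finset.card_le_one.1 hs _
      (Finset.mem_image_of_mem g (Finset.mem_univ _)) _
      (Finset.mem_image_of_mem g (Finset.mem_univ _))
    have himage : Finset.univ.image g = {g ⟨i₀, hi₀⟩} := by
      refine Finset.eq_singleton_iff_unique_mem.2
        ⟨Finset.mem_image_of_mem g (Finset.mem_univ _), fun b hb' => ?_⟩
      obtain ⟨i, -, rfl⟩ := Finset.mem_image.1 hb'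
      exact hb i
    have hempty : commonPart (fun i => ({j | z i j ≠ 0} : Finset (Fin n)))
        {i | g i = g ⟨i₀, hi₀⟩} = ∅ := by
      refine Finset.eq_empty_of_forall_notMem fun j hj => ?_
      obtain ⟨i, hi, hij⟩ := hu'0 j
      rw [mem_commonPart] at hj
      have := hj ⟨i, hi⟩ (by simp [hb])
      rw [Finset.mem_filter] at this
      apply this.2
      rw [← sub_eq_zero] at hij
      simpa [hz, sub_add_eq_sub_sub] using hij
    rw [himage, Finset.sum_singleton, Finset.card_singleton, hempty]
    simp

/-! ### Dual codes and the relaxed radius -/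

theorem finrank_dualCode_add {F : Type*} [Field F] {n : ℕ} (C : Submodule F (Fin n → F)) :
    finrank F (dualCode C) + finrank F C = n := by
  have h : (dualCode C).map (dotProductEquiv F (Fin n)).toLinearMap = C.dualAnnihilator := by
    ext f
    rw [Submodule.mem_map_equiv, Submodule.mem_dualAnnihilator]
    refine forall₂_congr fun c _ => ?_
    rw [dotProduct_comm]
    conv_rhs => rw [← (dotProductEquiv F (Fin n)).apply_symm_apply f]
    rfl
  have h2 := Subspace.finrank_add_finrank_dualAnnihilator_eq C
  rw [← h, LinearEquiv.finrank_map_eq, Module.finrank_fin_fun] at h2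
  omega

theorem exists_isGeneratorMatrix {F : Type*} [Field F] {k n : ℕ} {C : Submodule F (Fin n → F)}
    (h : finrank F C = k) : ∃ G : Matrix (Fin k) (Fin n) F, IsGeneratorMatrix G C := by
  let b := Module.finBasisOfFinrankEq F C h
  refine ⟨Matrix.of fun i => (b i : Fin n → F), ?_, ?_⟩
  · exact b.linearIndependent.map' C.subtype C.ker_subtype
  · change Submodule.span F (Set.range (C.subtype ∘ b)) = C
    rw [Set.range_comp, ← Submodule.map_span, b.span_eq, Submodule.map_top, C.range_subtype]

/-- A generator matrix of the dual code is a parity check matrix. -/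
theorem IsGeneratorMatrix.mem_iff_of_dualCode {F : Type*} [Field F] {m n : ℕ}
    {C : Submodule F (Fin n → F)} {H : Matrix (Fin m) (Fin n) F}
    (h : IsGeneratorMatrix H (dualCode C)) (c : Fin n → F) : c ∈ C ↔ H.mulVec c = 0 := by
  have hle : C ≤ LinearMap.ker H.mulVecLin := by
    intro c hc
    ext r
    have hr : H.row r ∈ dualCode C := h.2 ▸ Submodule.subset_span ⟨r, rfl⟩
    exact (dotProduct_comm _ _).trans (hr c hc)
  have hm : finrank F (dualCode C) = m := by
    rw [← h.2, finrank_span_eq_card h.1, Fintype.card_fin]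
  have h1 := H.mulVecLin.finrank_range_add_finrank_ker
  have h2 : finrank F (LinearMap.range H.mulVecLin) = m :=
    h.1.rank_matrix.trans (Fintype.card_fin m)
  rw [h2, Module.finrank_fin_fun] at h1
  have h3 := finrank_dualCode_add C
  rw [Submodule.eq_of_le_of_finrank_eq hle (by omega)]
  simp

/-- The average-radius condition, with denominators cleared, in terms of the total weight `w`. -/
theorem relaxedRadius_mul_lt_iff {n k d : ℕ} (hn : n ≠ 0) (hk : k ≤ n) (hd : d ≤ n - k) (ℓ w : ℕ) :
    relaxedRadius n k d ℓ * n < 1 / ((ℓ : ℝ) + 1) * w ↔ ℓ * (n - k - d) < w := by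
  have hn' : (n : ℝ) ≠ 0 := Nat.cast_ne_zero.2 hn
  have hl : (0 : ℝ) < (ℓ : ℝ) + 1 := by positivity
  have h1 : relaxedRadius n k d ℓ * n = 1 / ((ℓ : ℝ) + 1) * ((ℓ * (n - k - d) : ℕ) : ℝ) := by
    rw [relaxedRadius, Nat.cast_mul, Nat.cast_sub hd, Nat.cast_sub hk]
    field_simp
  rw [h1, mul_lt_mul_iff_right₀ (by positivity), Nat.cast_lt]

/-! ### Equivalence of list decodability and the dual condition -/

/-- The left-to-right implication, for an arbitrary `(n - k - d) × n` matrix `W` in place of the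
generic one. -/
theorem IsRelaxedLDMDSLe.intersectTrivially {F K : Type*} [Field F] [DecidableEq F] [Field K]
    {n k d L : ℕ} {C : Submodule F (Fin n → F)} (hkn : k ≤ n) (hd : d ≤ n - k)
    (hC : IsRelaxedLDMDSLe k C d L) {m : ℕ} {H : Matrix (Fin m) (Fin n) F}
    (hH : IsGeneratorMatrix H (dualCode C)) {A : Fin (L + 1) → Finset (Fin n)}
    {W : Matrix (Fin (n - k - d)) (Fin n) K} (hW : IntersectTrivially W A) :
    IntersectTrivially H A := by
  intro x hx hHx
  -- `z` enumerates the distinct values of `x`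
  obtain ⟨ℓ, hℓ⟩ : ∃ ℓ, (Finset.univ.image x).card = ℓ + 1 :=
    Nat.exists_eq_succ_of_ne_zero (Finset.card_pos.2 (Finset.univ_nonempty.image x)).ne'
  let e := Finset.equivFinOfCardEq hℓ
  let z : Fin (ℓ + 1) → Fin n → F := fun b => (e.symm b : Fin n → F)
  let π : Fin (L + 1) → Fin (ℓ + 1) :=
    fun i => e ⟨x i, Finset.mem_image_of_mem x (Finset.mem_univ i)⟩
  have hzπ : ∀ i, z (π i) = x i := fun i => by simp [z, π]
  have hzinj : Function.Injective z := Subtype.val_injective.comp e.symm.injective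
  have hπ : Function.Surjective π := fun b => by
    obtain ⟨i, -, hi⟩ := Finset.mem_image.1 (e.symm b).2
    exact ⟨i, hzinj ((hzπ i).trans hi)⟩
  let B : Fin (ℓ + 1) → Finset (Fin n) := fun b => commonPart A {i | π i = b}
  have hB : IntersectTrivially W B := by
    intro w hw hWw
    have h0 := hW (w ∘ π) (fun i j hj => hw _ _ fun hjB =>
      hj (mem_commonPart.1 hjB i (by simp))) fun _ _ => hWw _ _
    funext b
    obtain ⟨i, rfl⟩ := hπ b
    exact congrFun h0 i
  have hcount := hB.sum_card_add_le
  have hwt : ∀ b, hammingNorm (z b) ≤ (B b).card := by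
    intro b
    refine Finset.card_le_card fun j hj => mem_commonPart.2 fun i hi => ?_
    rw [Finset.mem_filter] at hi hj
    by_contra hji
    exact hj.2 (by rw [← hi.2, hzπ, hx i j hji])
  have hsum := Finset.sum_le_sum fun b (_ : b ∈ Finset.univ) => hwt b
  rw [Nat.succ_mul] at hcount
  obtain rfl | hℓ0 := Nat.eq_zero_or_pos ℓ
  -- if all `x i` are equal, the bound says that the intersection of all `A i` is empty
  · have h0 : hammingNorm (z 0) = 0 := by
      simp only [Nat.reduceAdd, Fin.sum_univ_one] at hsum hcount
      omega
    funext i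
    rw [← hzπ i, Subsingleton.elim (α := Fin 1) (π i) 0]
    exact hammingNorm_eq_zero.1 h0
  · exfalso
    have hℓL : ℓ ≤ L := by
      have := Finset.card_image_le (s := Finset.univ) (f := x)
      rw [hℓ, Finset.card_univ, Fintype.card_fin] at this
      omega
    have hn : n ≠ 0 := by
      rintro rfl
      have : (⟨0, by omega⟩ : Fin (ℓ + 1)) = ⟨1, by omega⟩ := hzinj (Subsingleton.elim _ _)
      simp at this
    have hlist := hC ℓ (Finset.mem_Icc.2 ⟨hℓ0, hℓL⟩) (z 0) (fun b => z 0 - z b)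
      (fun a b hab => hzinj (sub_right_injective hab)) fun b => by
        obtain ⟨i, hi⟩ := hπ 0
        obtain ⟨i', rfl⟩ := hπ b
        rw [hH.mem_iff_of_dualCode, ← hi, hzπ, hzπ, Matrix.mulVec_sub, hHx i i', sub_self]
    rw [← Nat.cast_sum, relaxedRadius_mul_lt_iff hn hkn hd] at hlist
    simp only [sub_sub_cancel] at hlist
    omega

theorem IsLowerRelaxedMatrix.isRelaxedLDMDSLe {F : Type*} [Field F] [DecidableEq F]
    {n k d L : ℕ} {C : Submodule F (Fin n → F)} (hkn : k ≤ n) (hd : d ≤ n - k)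
    {H : Matrix (Fin (n - k)) (Fin n) F} (hH : IsGeneratorMatrix H (dualCode C))
    (hlow : IsLowerRelaxedMatrix H d (L + 1)) : IsRelaxedLDMDSLe k C d L := by
  intro ℓ hℓ y c hinj hc
  rw [Finset.mem_Icc] at hℓ
  have hn : n ≠ 0 := by
    rintro rfl
    have : (⟨0, by omega⟩ : Fin (ℓ + 1)) = ⟨1, by omega⟩ := hinj (Subsingleton.elim _ _)
    simp at this
  rw [← Nat.cast_sum, relaxedRadius_mul_lt_iff hn hkn hd]
  by_contra! hle
  obtain ⟨J, u, hJ, hbound⟩ := exists_partitionBound (p := n - k - d) (fun i => y - c i)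
    (by rw [Fintype.card_fin]; omega) (by rw [Fintype.card_fin, Nat.succ_mul]; omega)
  have : Nonempty J := (Finset.card_pos.1 (by omega : 0 < J.card)).to_subtype
  obtain ⟨V, hV⟩ := hbound.exists_intersectTrivially F
  -- the sublist may be shorter than `L + 1`; repeat members to reach this length
  obtain ⟨f⟩ : Nonempty (J ↪ Fin (L + 1)) := Function.Embedding.nonempty_of_card_le (by
    have := J.card_le_univ
    simp only [Fintype.card_coe, Fintype.card_fin] at this ⊢
    omega)
  have hπ := Function.invFun_surjective f.injective
  set π := Function.invFun f
  have hgen := hlow _ (hasFullColumnRank_blockMatrix_genericMatrix V _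
    ((hasFullColumnRank_blockMatrix_iff V _).2 (hV.comp hπ)))
  rw [hasFullColumnRank_blockMatrix_iff] at hgen
  have hzero := hgen (fun i => y - c (π i) - u)
    (fun i j hj => by simpa [sub_eq_zero] using hj) fun i i' => by
      simp only [Matrix.mulVec_sub, (hH.mem_iff_of_dualCode _).1 (hc _)]
  obtain ⟨a, ha, b, hb, hab⟩ := Finset.one_lt_card.1 hJ
  have hval : ∀ a ∈ J, y - c a = u := fun a ha => by
    obtain ⟨i, hi⟩ := hπ ⟨a, ha⟩
    simpa [hi, sub_eq_zero] using congrFun hzero i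
  exact hab (hinj (sub_right_injective ((hval a ha).trans (hval b hb).symm)))

theorem mainTheorem4 {F : Type*} [Field F] [DecidableEq F] (n k d L : ℕ)
    (C : Submodule F (Fin n → F)) (hk : Module.finrank F C = k) (hd : d ≤ n - k) (hL : 1 ≤ L) :
    IsRelaxedLDMDSLe k C d L ↔ IsLowerRelaxedMDS (n - k) (dualCode C) d (L + 1) := by
  have hdim := finrank_dualCode_add C
  have hkn : k ≤ n := by omega
  constructor
  · intro hC
    obtain ⟨H, hH⟩ := exists_isGeneratorMatrix (C := dualCode C) (k := n - k) (by omega)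
    refine ⟨H, hH, fun A hA => ?_⟩
    rw [hasFullColumnRank_blockMatrix_iff] at hA ⊢
    exact hC.intersectTrivially hkn hd hH hA
  · rintro ⟨H, hH, hlow⟩
    exact hlow.isRelaxedLDMDSLe hkn hd hH
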